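/- Let $\mathbf C$ be a $\dagger$-symmetric monoidal category, i.e. a symmetric monoidal category with an identity-on-objects contravariant endofunctor $(-)^\dagger$ such that $f^{\dagger\dagger}=f$, $(f\otimes g)^\dagger=f^\dagger\otimes g^\dagger$, and such that the structure isomorphisms (associators, unitors, symmetry) are unitary: $\theta^{-1}=\theta^\dagger$. Let $(A,\delta:A\to A\otimes A,\epsilon:A\to I)$ be an observable structure in $\mathbf C$, i.e. an internal cocommutative comonoid with $\delta^\dagger\circ\delta=1_A$ and $\delta\circ\delta^\dagger=(\delta^\dagger\otimes 1_A)\circ(1_A\otimes\delta)$ (structure isomorphisms are suppressed in formulas). For points $\psi,\phi:I\to A$ put $\psi\odot\phi:=\delta^\dagger\circ(\psi\otimes\phi)$; this is an associative and commutative operation with unit $\epsilon^\dagger$, and $\bigodot_i\psi_i$ denotes the product of a finite family (equal to $\epsilon^\dagger$ for the empty family). Put $\Lambda(\psi):=\delta^\dagger\circ(\psi\otimes 1_A):A\to A$. Let $A^{\otimes 0}=I$, $A^{\otimes 1}=A$, $A^{\otimes n}=A^{\otimes n-1}\otimes A$ for $n\ge 2$, and define $\delta_n:A\to A^{\otimes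 n}$ by $\delta_0=\epsilon$, $\delta_1=1_A$, and $$\delta_n=(\delta_{n-1}\otimes 1_A)\circ\delta=(\delta\otimes 1_{A^{\otimes n-2}})\circ(\delta\otimes 1_{A^{\otimes n-3}})\circ\cdots\circ(\delta\otimes 1_A)\circ\delta\qquad(n\ge 2).$$ **Theorem.** Let $n,m\ge 0$ and let $f:A^{\otimes n}\to A^{\otimes m}$ be a morphism given by a diagram built, by composition and tensor product, from identities, $\delta$, $\epsilon$, the structure maps of the symmetric monoidal category (at tensor products of copies of $A$ and $I$), the adjoints of all of these, and points $\psi_i:I\to A$, where $i$ ranges over the occurrences of points in the diagram (so the $\psi_i$ need not be distinct). Suppose that the graphical representation of this diagram is connected (in particular non-empty); here each occurrence of $\delta$, $\epsilon$, $\delta^\dagger$, $\epsilon^\dagger$ or of a point is a dot with its input and output wires attached, identities and structure maps consist of plain wires, one for each copy of $A$ (none for $I$), composition joins matching wires, and tensor product is juxtaposition. Then $$f=\delta_m\circ\Lambda\Bigl(\bigodot_i\psi_i\Bigr)\circ\delta_n^\dagger .$$ -/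

import Mathlib

open CategoryTheory MonoidalCategory

universe v u

/-- A dagger symmetric monoidal category: a symmetric monoidal category with an involutive,
identity-on-objects contravariant endofunctor that preserves the tensor product of morphisms,
and for which all structure isomorphisms are unitary. -/
class DaggerSymmetricCategory (C : Type u) [Category.{v} C] [MonoidalCategory C]
    [SymmetricCategory C] where
  /-- The adjoint of a morphism. -/
  dagger : {X Y : C} → (X ⟶ Y) → (Y ⟶ X)
  dagger_id (X : C) : dagger (𝟙 X) = 𝟙 X
  dagger_comp {X Y Z : C} (f : X ⟶ Y) (g : Y ⟶ Z) : dagger (f ≫ g) = dagger g ≫ dagger f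
  dagger_dagger {X Y : C} (f : X ⟶ Y) : dagger (dagger f) = f
  dagger_tensor {X₁ Y₁ X₂ Y₂ : C} (f : X₁ ⟶ Y₁) (g : X₂ ⟶ Y₂) :
    dagger (f ⊗ₘ g) = dagger f ⊗ₘ dagger g
  dagger_associator (X Y Z : C) : dagger (α_ X Y Z).hom = (α_ X Y Z).inv
  dagger_leftUnitor (X : C) : dagger (λ_ X).hom = (λ_ X).inv
  dagger_rightUnitor (X : C) : dagger (ρ_ X).hom = (ρ_ X).inv
  dagger_braiding (X Y : C) : dagger (β_ X Y).hom = (β_ X Y).inv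

open DaggerSymmetricCategory (dagger)

/-- An observable structure on `A`: an internal cocommutative comonoid `(A, δ, ε)`, with
`δ = ComonObj.comul` and `ε = ComonObj.counit`, that is special (`δ† ∘ δ = 1`) and satisfies the
Frobenius law (`δ ∘ δ† = (δ† ⊗ 1) ∘ (1 ⊗ δ)`). -/
class ObservableStructure {C : Type u} [Category.{v} C] [MonoidalCategory C]
    [SymmetricCategory C] [DaggerSymmetricCategory C] (A : C)
    extends ComonObj A, IsCommComonObj A where
  special : (ComonObj.comul : A ⟶ A ⊗ A) ≫ dagger (ComonObj.comul : A ⟶ A ⊗ A) = 𝟙 A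
  frobenius : dagger (ComonObj.comul : A ⟶ A ⊗ A) ≫ (ComonObj.comul : A ⟶ A ⊗ A) =
    (A ◁ (ComonObj.comul : A ⟶ A ⊗ A)) ≫ (α_ A A A).inv ≫
      (dagger (ComonObj.comul : A ⟶ A ⊗ A) ▷ A)

namespace ObservableStructure

/-- Formal tensor words in a single object and the monoidal unit. -/
inductive Word : Type
  | unit : Word
  | obj : Word
  | tensor : Word → Word → Word

namespace Word

/-- The tensor powers: `unit`, `obj`, `obj ⊗ obj`, `(obj ⊗ obj) ⊗ obj`, ... -/
def pow : ℕ → Word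
  | 0 => unit
  | 1 => obj
  | n + 2 => tensor (pow (n + 1)) obj

/-- The wires of a word, that is, the occurrences of the object in it. -/
def Wires : Word → Type
  | unit => Empty
  | obj => Unit
  | tensor X Y => X.Wires ⊕ Y.Wires

/-- The object that a word denotes when its letter denotes `A`. -/
def eval {C : Type u} [Category.{v} C] [MonoidalCategory C] (A : C) : Word → C
  | unit => 𝟙_ C
  | obj => A
  | tensor X Y => X.eval A ⊗ Y.eval A

end Word

/-- A graph with input wires indexed by `ι` and output wires indexed by `ο`: a graph together with
the vertices to which the inputs and the outputs are attached. -/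
structure OpenGraph (ι ο : Type) where
  /-- The vertices: the dots of a diagram, and its pieces of plain wire. -/
  V : Type
  graph : SimpleGraph V
  input : ι → V
  output : ο → V

namespace OpenGraph

/-- Plain wires from `ι` to `ο`, one for each input and each output. -/
def wires {ι ο : Type} (e : ι ≃ ο) : OpenGraph ι ο where
  V := ι
  graph := ⊥
  input := id
  output := e.symm

/-- A single dot to which all inputs and outputs are attached. -/
def dot (ι ο : Type) : OpenGraph ι ο where
  V := Unit
  graph := ⊥
  input _ := ()
  output _ := ()

/-- The upside-down graph. -/
def flip {ι ο : Type} (G : OpenGraph ι ο) : OpenGraph ο ι where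
  V := G.V
  graph := G.graph
  input := G.output
  output := G.input

/-- Juxtaposition. -/
def tensor {ι₁ ο₁ ι₂ ο₂ : Type} (G : OpenGraph ι₁ ο₁) (H : OpenGraph ι₂ ο₂) :
    OpenGraph (ι₁ ⊕ ι₂) (ο₁ ⊕ ο₂) where
  V := G.V ⊕ H.V
  graph := G.graph ⊕g H.graph
  input := Sum.map G.input H.input
  output := Sum.map G.output H.output

/-- Composition: each output of the first graph is joined to the matching input of the second. -/
def comp {ι κ ο : Type} (G : OpenGraph ι κ) (H : OpenGraph κ ο) : OpenGraph ι ο where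
  V := G.V ⊕ H.V
  graph := (G.graph ⊕g H.graph) ⊔
    SimpleGraph.fromRel
      (fun a b => ∃ k : κ, a = Sum.inl (G.output k) ∧ b = Sum.inr (H.input k))
  input := Sum.inl ∘ G.input
  output := Sum.inr ∘ H.output

end OpenGraph

/-- The generators: the comultiplication, the counit, and the structure maps of a symmetric
monoidal category. -/
inductive Gen : Word → Word → Type
  | comul : Gen Word.obj (Word.tensor Word.obj Word.obj)
  | counit : Gen Word.obj Word.unit
  | associator (X Y Z : Word) :
      Gen (Word.tensor (Word.tensor X Y) Z) (Word.tensor X (Word.tensor Y Z))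
  | leftUnitor (X : Word) : Gen (Word.tensor Word.unit X) X
  | rightUnitor (X : Word) : Gen (Word.tensor X Word.unit) X
  | braiding (X Y : Word) : Gen (Word.tensor X Y) (Word.tensor Y X)

namespace Gen

/-- The graphical representation of a generator: `δ` and `ε` are dots, and the structure maps
consist of plain wires. -/
def graph : {X Y : Word} → Gen X Y → OpenGraph X.Wires Y.Wires
  | _, _, comul => OpenGraph.dot _ _
  | _, _, counit => OpenGraph.dot _ _
  | _, _, associator X Y Z => OpenGraph.wires (Equiv.sumAssoc X.Wires Y.Wires Z.Wires)
  | _, _, leftUnitor X => OpenGraph.wires (Equiv.emptySum Empty X.Wires)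
  | _, _, rightUnitor X => OpenGraph.wires (Equiv.sumEmpty X.Wires Empty)
  | _, _, braiding X Y => OpenGraph.wires (Equiv.sumComm X.Wires Y.Wires)

/-- The morphism that a generator denotes. -/
def eval {C : Type u} [Category.{v} C] [MonoidalCategory C] [SymmetricCategory C]
    [DaggerSymmetricCategory C] (A : C) [ObservableStructure A] :
    {X Y : Word} → Gen X Y → (X.eval A ⟶ Y.eval A)
  | _, _, comul => (ComonObj.comul : A ⟶ A ⊗ A)
  | _, _, counit => (ComonObj.counit : A ⟶ 𝟙_ C)
  | _, _, associator X Y Z => (α_ (X.eval A) (Y.eval A) (Z.eval A)).hom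
  | _, _, leftUnitor X => (λ_ (X.eval A)).hom
  | _, _, rightUnitor X => (ρ_ (X.eval A)).hom
  | _, _, braiding X Y => (β_ (X.eval A) (Y.eval A)).hom

end Gen

/-- Diagrams generated under composition and tensor product by the generators, their adjoints, and
points of `A`. -/
inductive Diagram {C : Type u} [Category.{v} C] [MonoidalCategory C] (A : C) :
    Word → Word → Type v
  | id (X : Word) : Diagram A X X
  | gen {X Y : Word} (g : Gen X Y) : Diagram A X Y
  | genDagger {X Y : Word} (g : Gen X Y) : Diagram A Y X
  | point (ψ : 𝟙_ C ⟶ A) : Diagram A Word.unit Word.obj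
  | comp {X Y Z : Word} (D : Diagram A X Y) (E : Diagram A Y Z) : Diagram A X Z
  | tensor {X₁ Y₁ X₂ Y₂ : Word} (D : Diagram A X₁ Y₁) (E : Diagram A X₂ Y₂) :
      Diagram A (Word.tensor X₁ X₂) (Word.tensor Y₁ Y₂)

namespace Diagram

/-- The graphical representation of a diagram. -/
def graph {C : Type u} [Category.{v} C] [MonoidalCategory C] {A : C} :
    {X Y : Word} → Diagram A X Y → OpenGraph X.Wires Y.Wires
  | _, _, id X => OpenGraph.wires (Equiv.refl X.Wires)
  | _, _, gen g => g.graph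
  | _, _, genDagger g => g.graph.flip
  | _, _, point _ => OpenGraph.dot _ _
  | _, _, comp D E => D.graph.comp E.graph
  | _, _, tensor D E => D.graph.tensor E.graph

/-- A diagram is connected if its graphical representation is connected, in particular not
empty. -/
def Connected {C : Type u} [Category.{v} C] [MonoidalCategory C] {A : C} {X Y : Word}
    (D : Diagram A X Y) : Prop :=
  D.graph.graph.Connected

/-- The points that occur in a diagram, each as often as it occurs. -/
def points {C : Type u} [Category.{v} C] [MonoidalCategory C] {A : C} :
    {X Y : Word} → Diagram A X Y → List (𝟙_ C ⟶ A)
  | _, _, id _ => []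
  | _, _, gen _ => []
  | _, _, genDagger _ => []
  | _, _, point ψ => [ψ]
  | _, _, comp D E => D.points ++ E.points
  | _, _, tensor D E => D.points ++ E.points

/-- The morphism that a diagram denotes. -/
def eval {C : Type u} [Category.{v} C] [MonoidalCategory C] [SymmetricCategory C]
    [DaggerSymmetricCategory C] {A : C} [ObservableStructure A] :
    {X Y : Word} → Diagram A X Y → (X.eval A ⟶ Y.eval A)
  | _, _, id X => 𝟙 (X.eval A)
  | _, _, gen g => g.eval A
  | _, _, genDagger g => dagger (g.eval A)
  | _, _, point ψ => ψ
  | _, _, comp D E => D.eval ≫ E.eval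
  | _, _, tensor D E => D.eval ⊗ₘ E.eval

end Diagram

variable {C : Type u} [Category.{v} C] [MonoidalCategory C] [SymmetricCategory C]
  [DaggerSymmetricCategory C]

/-- The tensor power `A^{⊗ n}`, bracketed to the left: `𝟙_ C`, `A`, `A ⊗ A`, `(A ⊗ A) ⊗ A`, ... -/
abbrev tensorPow (A : C) (n : ℕ) : C := (Word.pow n).eval A

/-- The iterated comultiplication `δ_n : A ⟶ A^{⊗ n}`: `δ_0 = ε`, `δ_1 = 1`, and
`δ_n = (δ_{n-1} ⊗ 1) ∘ δ = (δ ⊗ 1_{A^{⊗ n-2}}) ∘ ... ∘ (δ ⊗ 1_A) ∘ δ`. -/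
def copy (A : C) [ObservableStructure A] : (n : ℕ) → (A ⟶ tensorPow A n)
  | 0 => (ComonObj.counit : A ⟶ 𝟙_ C)
  | 1 => 𝟙 A
  | n + 2 => (ComonObj.comul : A ⟶ A ⊗ A) ≫ (copy A (n + 1) ▷ A)

/-- The multiplication of points, `ψ ⊙ φ = δ† ∘ (ψ ⊗ φ)`. -/
def pointMul {A : C} [ObservableStructure A] (ψ φ : 𝟙_ C ⟶ A) : 𝟙_ C ⟶ A :=
  (λ_ (𝟙_ C)).inv ≫ (ψ ⊗ₘ φ) ≫ dagger (ComonObj.comul : A ⟶ A ⊗ A)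

/-- The product of a list of points under `⊙`, with unit `ε†`. -/
def pointProd {A : C} [ObservableStructure A] : List (𝟙_ C ⟶ A) → (𝟙_ C ⟶ A)
  | [] => dagger (ComonObj.counit : A ⟶ 𝟙_ C)
  | ψ :: l => pointMul ψ (pointProd l)

/-- The endomorphism `Λ(ψ) = δ† ∘ (ψ ⊗ 1_A)`. -/
def phase {A : C} [ObservableStructure A] (ψ : 𝟙_ C ⟶ A) : A ⟶ A :=
  (λ_ A).inv ≫ (ψ ▷ A) ≫ dagger (ComonObj.comul : A ⟶ A ⊗ A)

end ObservableStructure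

namespace ObservableStructure

open ComonObj MonObj BraidedCategory

/-! ### The Frobenius monoid on `A` and the Kleisli category of `A ⊗ -`. -/

section Algebra

/-! A direct induction fails, because the parts of a connected diagram need not be connected.
Instead the diagram gets one extra output, a control wire of type `A`, to which every vertex of a
chosen set `S` is joined by `δ`; this is `ctl D S`. Such maps `X ⟶ A ⊗ Y` compose and tensor as
Kleisli maps of the monad `A ⊗ -` (`kcomp`, `ktensor`), the control wires of the parts being merged
by `δ†`.

Three facts carry the proof. Joining one vertex and then discarding the control wire by `ε` changes
nothing (`cap_ctl_singleton`). If `v ∈ S`, joining a neighbour of `v` as well changes nothing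
(`ctl_insert_of_adj`): a connection slides between the wires of a dot by coassociativity,
cocommutativity and the Frobenius law, and a repeated connection counts once because `δ† ∘ δ = 1`.
If all vertices are joined, the normal form follows by induction for every diagram, connected or
not, since the control wire connects everything (`ctl_univ`).

In a connected graph the second fact leads from `{v}` to the set of all vertices
(`apply_singleton_eq_univ`). Discarding the control wire in the normal form then gives the theorem.
-/

lemma tensorμ_braiding {C : Type u} [Category.{v} C] [MonoidalCategory C]
    [SymmetricCategory C] (X₁ X₂ Y₁ Y₂ : C) :
    tensorμ X₁ X₂ Y₁ Y₂ ≫ ((β_ X₁ Y₁).hom ⊗ₘ (β_ X₂ Y₂).hom) =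
      (β_ (X₁ ⊗ X₂) (Y₁ ⊗ Y₂)).hom ≫ tensorμ Y₁ Y₂ X₁ X₂ := by
  have h : Y₁ ◁ (β_ X₁ Y₂).hom ▷ X₂ ≫ Y₁ ◁ (β_ Y₂ X₁).hom ▷ X₂ = 𝟙 _ := by
    simp only [← whiskerLeft_comp, ← comp_whiskerRight, SymmetricCategory.symmetry,
      id_whiskerRight, whiskerLeft_id]
  simp [tensorμ, BraidedCategory.braiding_tensor_left_hom,
    BraidedCategory.braiding_tensor_right_hom, MonoidalCategory.tensorHom_def, reassoc_of% h]

variable {C : Type u} [Category.{v} C] [MonoidalCategory C] [SymmetricCategory C]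
  [DaggerSymmetricCategory C]

lemma dagger_whiskerRight {X Y : C} (f : X ⟶ Y) (Z : C) : dagger (f ▷ Z) = dagger f ▷ Z := by
  rw [← tensorHom_id, DaggerSymmetricCategory.dagger_tensor, DaggerSymmetricCategory.dagger_id,
    tensorHom_id]

lemma dagger_whiskerLeft (Z : C) {X Y : C} (f : X ⟶ Y) : dagger (Z ◁ f) = Z ◁ dagger f := by
  rw [← id_tensorHom, DaggerSymmetricCategory.dagger_tensor, DaggerSymmetricCategory.dagger_id,
    id_tensorHom]

lemma dagger_leftUnitor_inv (X : C) : dagger (λ_ X).inv = (λ_ X).hom := by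
  rw [← DaggerSymmetricCategory.dagger_leftUnitor, DaggerSymmetricCategory.dagger_dagger]

lemma dagger_rightUnitor_inv (X : C) : dagger (ρ_ X).inv = (ρ_ X).hom := by
  rw [← DaggerSymmetricCategory.dagger_rightUnitor, DaggerSymmetricCategory.dagger_dagger]

lemma dagger_injective {X Y : C} {f g : X ⟶ Y} (h : dagger f = dagger g) : f = g := by
  rw [← DaggerSymmetricCategory.dagger_dagger f, h, DaggerSymmetricCategory.dagger_dagger]

variable {A : C} [ObservableStructure A]

/-- The commutative monoid with multiplication `δ†` and unit `ε†`. -/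
instance monObj : MonObj A where
  one := dagger (counit : A ⟶ 𝟙_ C)
  mul := dagger (comul : A ⟶ A ⊗ A)
  one_mul := by
    rw [← dagger_whiskerRight, ← DaggerSymmetricCategory.dagger_comp, ComonObj.counit_comul,
      dagger_leftUnitor_inv]
  mul_one := by
    rw [← dagger_whiskerLeft, ← DaggerSymmetricCategory.dagger_comp, ComonObj.comul_counit,
      dagger_rightUnitor_inv]
  mul_assoc := by
    have h := congrArg dagger (ComonObj.comul_assoc A)
    simp only [DaggerSymmetricCategory.dagger_comp, dagger_whiskerLeft, dagger_whiskerRight,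
      DaggerSymmetricCategory.dagger_associator, Category.assoc] at h
    rw [h, Iso.hom_inv_id_assoc]

instance isCommMonObj : IsCommMonObj A where
  mul_comm := by
    have h := congrArg dagger (IsCommComonObj.comul_comm A)
    rw [DaggerSymmetricCategory.dagger_comp, DaggerSymmetricCategory.dagger_braiding] at h
    rw [SymmetricCategory.braiding_swap_eq_inv_braiding]
    exact h

lemma dagger_comul : dagger (comul : A ⟶ A ⊗ A) = mul := rfl

lemma dagger_counit : dagger (counit : A ⟶ 𝟙_ C) = one := rfl

lemma dagger_mul : dagger (mul : A ⊗ A ⟶ A) = comul :=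
  DaggerSymmetricCategory.dagger_dagger _

lemma comul_mul : (comul : A ⟶ A ⊗ A) ≫ mul = 𝟙 A := special

lemma mul_comul_right : (mul : A ⊗ A ⟶ A) ≫ comul =
    (A ◁ (comul : A ⟶ A ⊗ A)) ≫ (α_ A A A).inv ≫ (mul ▷ A) := frobenius

/-- This is the adjoint of the Frobenius law. -/
lemma mul_comul_left : (mul : A ⊗ A ⟶ A) ≫ comul =
    ((comul : A ⟶ A ⊗ A) ▷ A) ≫ (α_ A A A).hom ≫ (A ◁ mul) := by
  apply dagger_injective
  simpa only [DaggerSymmetricCategory.dagger_comp, dagger_whiskerLeft, dagger_whiskerRight,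
    DaggerSymmetricCategory.dagger_associator, dagger_mul, dagger_comul, Category.assoc]
    using mul_comul_right (A := A)

/-- The Frobenius law with the first copy of the left factor multiplied into the right one. -/
lemma mul_comul_swap : (mul : A ⊗ A ⟶ A) ≫ comul =
    ((comul : A ⟶ A ⊗ A) ▷ A) ≫ (α_ A A A).hom ≫ A ◁ (β_ A A).hom ≫ (α_ A A A).inv ≫
      (mul ▷ A) := by
  have h : (mul : A ⊗ A ⟶ A) ≫ comul = (β_ A A).hom ≫ mul ≫ comul := by
    rw [← Category.assoc, IsCommMonObj.mul_comm]
  rw [h, mul_comul_right, ← BraidedCategory.braiding_naturality_left_assoc]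
  simp [BraidedCategory.braiding_tensor_left_hom, ← comp_whiskerRight]

/-- The action of `A` on the free module `A ⊗ X`. -/
def act (X : C) : A ⊗ (A ⊗ X) ⟶ A ⊗ X := (α_ A A X).inv ≫ mul ▷ X

lemma act_naturality {X Y : C} (f : X ⟶ Y) :
    A ◁ A ◁ f ≫ act (A := A) Y = act X ≫ A ◁ f := by
  simp only [act, Category.assoc, ← MonoidalCategory.whisker_exchange,
    associator_inv_naturality_right_assoc]

lemma act_act (X : C) : A ◁ act (A := A) X ≫ act X = act (A ⊗ X) ≫ act X := by
  have h : (A ◁ (mul : A ⊗ A ⟶ A)) ≫ mul = (α_ A A A).inv ≫ mul ▷ A ≫ mul := by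
    rw [MonObj.mul_assoc, Iso.inv_hom_id_assoc]
  simp only [act, Category.assoc, whiskerLeft_comp, associator_inv_naturality_middle_assoc,
    associator_inv_naturality_left_assoc,
    ← comp_whiskerRight, h]
  simp only [comp_whiskerRight, pentagon_inv_assoc]

/-- The unit of the monad `A ⊗ -`. -/
def kunit (A : C) [ObservableStructure A] (X : C) : X ⟶ A ⊗ X := (λ_ X).inv ≫ one ▷ X

lemma kunit_naturality {X Y : C} (f : X ⟶ Y) : f ≫ kunit A Y = kunit A X ≫ A ◁ f := by
  simp only [kunit, Category.assoc, ← MonoidalCategory.whisker_exchange,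
    leftUnitor_inv_naturality_assoc]

@[simp]
lemma kunit_act (X : C) : kunit A (A ⊗ X) ≫ act X = 𝟙 _ := by
  have h := MonObj.one_mul A
  simp only [kunit, act, Category.assoc, associator_inv_naturality_left_assoc,
    ← comp_whiskerRight, h]
  simp

@[simp]
lemma whiskerLeft_kunit_act (X : C) : A ◁ kunit A X ≫ act X = 𝟙 _ := by
  have h := MonObj.mul_one A
  simp only [kunit, act, Category.assoc, whiskerLeft_comp,
    associator_inv_naturality_middle_assoc, ← comp_whiskerRight, h]
  simp

/-- Composition in the Kleisli category of `A ⊗ -`. -/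
def kcomp {X Y Z : C} (f : X ⟶ A ⊗ Y) (g : Y ⟶ A ⊗ Z) : X ⟶ A ⊗ Z := f ≫ A ◁ g ≫ act Z

/-- The tensor product in the Kleisli category of `A ⊗ -`. -/
def ktensor {X Y X' Y' : C} (f : X ⟶ A ⊗ Y) (g : X' ⟶ A ⊗ Y') : X ⊗ X' ⟶ A ⊗ (Y ⊗ Y') :=
  (f ⊗ₘ g) ≫ tensorμ A Y A Y' ≫ mul ▷ (Y ⊗ Y')

lemma kcomp_assoc {W X Y Z : C} (f : W ⟶ A ⊗ X) (g : X ⟶ A ⊗ Y) (h : Y ⟶ A ⊗ Z) :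
    kcomp (kcomp f g) h = kcomp f (kcomp g h) := by
  simp only [kcomp, Category.assoc, whiskerLeft_comp, act_act, reassoc_of% @act_naturality]

@[simp]
lemma kcomp_kunit {X Y : C} (f : X ⟶ A ⊗ Y) : kcomp f (kunit A Y) = f := by
  simp [kcomp]

@[simp]
lemma kunit_kcomp {X Y : C} (f : X ⟶ A ⊗ Y) : kcomp (kunit A X) f = f := by
  rw [kcomp, ← reassoc_of% @kunit_naturality, kunit_act, Category.comp_id]

lemma comp_kcomp {W X Y Z : C} (e : W ⟶ X) (f : X ⟶ A ⊗ Y) (g : Y ⟶ A ⊗ Z) :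
    kcomp (e ≫ f) g = e ≫ kcomp f g := by
  simp [kcomp]

lemma kcomp_whiskerLeft {W X Y Z : C} (f : W ⟶ A ⊗ X) (g : X ⟶ A ⊗ Y) (e : Y ⟶ Z) :
    kcomp f (g ≫ A ◁ e) = kcomp f g ≫ A ◁ e := by
  simp [kcomp, act_naturality]

lemma whiskerLeft_kcomp {W X Y Z : C} (f : W ⟶ A ⊗ X) (e : X ⟶ Y) (g : Y ⟶ A ⊗ Z) :
    kcomp (f ≫ A ◁ e) g = kcomp f (e ≫ g) := by
  simp [kcomp]

lemma comp_ktensor {W W' X Y X' Y' : C} (e : W ⟶ X) (e' : W' ⟶ X') (f : X ⟶ A ⊗ Y)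
    (g : X' ⟶ A ⊗ Y') : ktensor (e ≫ f) (e' ≫ g) = (e ⊗ₘ e') ≫ ktensor f g := by
  simp only [ktensor, ← tensorHom_comp_tensorHom, Category.assoc]

lemma ktensor_whiskerLeft {X Y Z X' Y' Z' : C} (f : X ⟶ A ⊗ Y) (e : Y ⟶ Z)
    (g : X' ⟶ A ⊗ Y') (e' : Y' ⟶ Z') :
    ktensor (f ≫ A ◁ e) (g ≫ A ◁ e') = ktensor f g ≫ A ◁ (e ⊗ₘ e') := by
  have h := tensorμ_natural (𝟙 A) e (𝟙 A) e'
  rw [tensorHom_id (𝟙 A), id_whiskerRight] at h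
  simp only [id_tensorHom] at h
  simp only [ktensor, ← tensorHom_comp_tensorHom, Category.assoc, reassoc_of% h,
    ← MonoidalCategory.whisker_exchange]

@[simp]
lemma ktensor_kunit (X Y : C) : ktensor (kunit A X) (kunit A Y) = kunit A (X ⊗ Y) := by
  have h := tensorμ_natural (one : 𝟙_ C ⟶ A) (𝟙 X) (one : 𝟙_ C ⟶ A) (𝟙 Y)
  simp only [tensorHom_id, id_whiskerRight] at h
  have h₁ : (one ⊗ₘ one) ≫ (mul : A ⊗ A ⟶ A) = (λ_ (𝟙_ C)).hom ≫ one := by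
    rw [MonoidalCategory.tensorHom_def', Category.assoc, MonObj.one_mul, leftUnitor_naturality]
  have h₂ : ((λ_ X).inv ⊗ₘ (λ_ Y).inv) ≫ tensorμ (𝟙_ C) X (𝟙_ C) Y =
      (λ_ (X ⊗ Y)).inv ≫ (λ_ (𝟙_ C)).inv ▷ (X ⊗ Y) := by
    simp only [tensorμ, braiding_tensorUnit_right]
    monoidal
  simp only [kunit, ktensor, ← tensorHom_comp_tensorHom, Category.assoc,
    reassoc_of% h, reassoc_of% h₂, ← comp_whiskerRight, h₁, Iso.inv_hom_id_assoc]

/-- Commutativity of `mul` enters through `MonObj.mul_mul_mul_comm`: four control wires may be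
merged in either grouping. This is the core of the interchange law `ktensor_kcomp`. -/
lemma act_tensor (X Y : C) :
    tensorμ A (A ⊗ X) A (A ⊗ Y) ≫ (mul ⊗ₘ (tensorμ A X A Y ≫ mul ▷ (X ⊗ Y))) ≫ act (X ⊗ Y) =
      (act X ⊗ₘ act Y) ≫ tensorμ A X A Y ≫ mul ▷ (X ⊗ Y) := by
  have h := associator_monoidal A A X A A Y
  have h₁ := MonObj.mul_mul_mul_comm A
  have h₂ := tensorμ_natural (mul : A ⊗ A ⟶ A) (𝟙 X) (mul : A ⊗ A ⟶ A) (𝟙 Y)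
  simp only [tensorHom_id, id_whiskerRight] at h₂
  have h₃ : (mul ⊗ₘ (tensorμ A X A Y ≫ mul ▷ (X ⊗ Y))) =
      (A ⊗ A) ◁ tensorμ A X A Y ≫ ((mul : A ⊗ A ⟶ A) ⊗ₘ ((mul : A ⊗ A ⟶ A) ⊗ₘ 𝟙 (X ⊗ Y))) := by
    rw [← id_tensorHom, tensorHom_comp_tensorHom, Category.id_comp, tensorHom_id]
  have h₄ : ((α_ A A X).hom ⊗ₘ (α_ A A Y).hom) ≫ (act X ⊗ₘ act Y) =
      (mul : A ⊗ A ⟶ A) ▷ X ⊗ₘ (mul : A ⊗ A ⟶ A) ▷ Y := by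
    simp only [tensorHom_comp_tensorHom, act, Iso.hom_inv_id_assoc]
  -- After the associators, each `act` is a plain `mul ▷ _`, so `associator_monoidal` applies.
  rw [← cancel_epi ((α_ A A X).hom ⊗ₘ (α_ A A Y).hom), reassoc_of% h₄, reassoc_of% h₂, h₃,
    Category.assoc, ← reassoc_of% h, ← MonoidalCategory.associator_naturality_assoc]
  simp only [act, Iso.hom_inv_id_assoc, tensorHom_id, ← comp_whiskerRight, h₁]

lemma ktensor_kcomp {X Y Z X' Y' Z' : C} (f : X ⟶ A ⊗ Y) (g : Y ⟶ A ⊗ Z)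
    (f' : X' ⟶ A ⊗ Y') (g' : Y' ⟶ A ⊗ Z') :
    kcomp (ktensor f f') (ktensor g g') = ktensor (kcomp f g) (kcomp f' g') := by
  have h := tensorμ_natural (𝟙 A) g (𝟙 A) g'
  rw [tensorHom_id (𝟙 A), id_whiskerRight] at h
  simp only [id_tensorHom] at h
  have h₁ : ∀ {U V : C} (t : U ⟶ V),
      ((mul : A ⊗ A ⟶ A) ⊗ₘ t) = mul ▷ U ≫ A ◁ t := fun t => MonoidalCategory.tensorHom_def _ _
  simp only [kcomp, ktensor, ← tensorHom_comp_tensorHom, Category.assoc, ← act_tensor,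
    reassoc_of% h, h₁, MonoidalCategory.whisker_exchange_assoc, whiskerLeft_comp]

/-- Like the unitor and braiding lemmas below, this lets connections to the control wire pass
through a structure map of the category. -/
lemma ktensor_associator {X X' Y Y' Z Z' : C} (f : X ⟶ A ⊗ X') (g : Y ⟶ A ⊗ Y')
    (h : Z ⟶ A ⊗ Z') :
    ktensor (ktensor f g) h ≫ A ◁ (α_ X' Y' Z').hom =
      (α_ X Y Z).hom ≫ ktensor f (ktensor g h) := by
  have h₁ := tensorμ_natural (mul : A ⊗ A ⟶ A) (𝟙 (X' ⊗ Y')) (𝟙 A) (𝟙 Z')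
  have h₂ := tensorμ_natural (𝟙 A) (𝟙 X') (mul : A ⊗ A ⟶ A) (𝟙 (Y' ⊗ Z'))
  have h₃ := tensor_associativity A X' A Y' A Z'
  simp only [tensorHom_id, id_tensorHom, id_whiskerRight] at h₁ h₂
  have h₄ : (mul : A ⊗ A ⟶ A) ▷ A ▷ ((X' ⊗ Y') ⊗ Z') ≫ mul ▷ _ ≫ A ◁ (α_ X' Y' Z').hom =
      ((α_ A A A).hom ⊗ₘ (α_ X' Y' Z').hom) ≫ (A ◁ mul) ▷ _ ≫ mul ▷ _ := by
    rw [MonoidalCategory.tensorHom_def', Category.assoc, ← comp_whiskerRight, ← comp_whiskerRight,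
      ← MonObj.mul_assoc, MonoidalCategory.whisker_exchange, comp_whiskerRight_assoc]
  have e₁ : (ktensor f g ⊗ₘ h) = ((f ⊗ₘ g) ⊗ₘ h) ≫ tensorμ A X' A Y' ▷ (A ⊗ Z') ≫
      (mul ▷ (X' ⊗ Y')) ▷ (A ⊗ Z') := by
    simp only [ktensor, ← tensorHom_id, tensorHom_comp_tensorHom, Category.comp_id]
  have e₂ : (f ⊗ₘ ktensor g h) = (f ⊗ₘ (g ⊗ₘ h)) ≫ (A ⊗ X') ◁ tensorμ A Y' A Z' ≫
      (A ⊗ X') ◁ mul ▷ (Y' ⊗ Z') := by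
    simp only [ktensor, ← id_tensorHom (A ⊗ X'), tensorHom_comp_tensorHom, Category.comp_id]
  rw [show ktensor (ktensor f g) h = (ktensor f g ⊗ₘ h) ≫ _ from rfl,
    show ktensor f (ktensor g h) = (f ⊗ₘ ktensor g h) ≫ _ from rfl, e₁, e₂]
  simp only [Category.assoc]
  rw [reassoc_of% h₁, reassoc_of% h₂, h₄, reassoc_of% h₃,
    MonoidalCategory.associator_naturality_assoc]

lemma ktensor_leftUnitor {X X' : C} (f : X ⟶ A ⊗ X') :
    ktensor (kunit A (𝟙_ C)) f ≫ A ◁ (λ_ X').hom = (λ_ X).hom ≫ f := by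
  have h := tensorμ_natural (one : 𝟙_ C ⟶ A) (𝟙 (𝟙_ C)) (𝟙 A) (𝟙 X')
  simp only [tensorHom_id, id_whiskerRight] at h
  have e : (kunit A (𝟙_ C) ⊗ₘ f) =
      (𝟙_ C) ◁ f ≫ (λ_ (𝟙_ C)).inv ▷ (A ⊗ X') ≫ (one ▷ (𝟙_ C)) ▷ (A ⊗ X') := by
    rw [MonoidalCategory.tensorHom_def', kunit, comp_whiskerRight]
  rw [ktensor, e]
  simp only [Category.assoc]
  rw [reassoc_of% h, ← comp_whiskerRight_assoc, MonObj.one_mul, ← MonoidalCategory.tensorHom_def,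
    ← tensor_left_unitality, leftUnitor_naturality]

lemma ktensor_rightUnitor {X X' : C} (f : X ⟶ A ⊗ X') :
    ktensor f (kunit A (𝟙_ C)) ≫ A ◁ (ρ_ X').hom = (ρ_ X).hom ≫ f := by
  have h := tensorμ_natural (𝟙 A) (𝟙 X') (one : 𝟙_ C ⟶ A) (𝟙 (𝟙_ C))
  simp only [tensorHom_id, id_tensorHom, id_whiskerRight] at h
  have e : (f ⊗ₘ kunit A (𝟙_ C)) =
      f ▷ (𝟙_ C) ≫ (A ⊗ X') ◁ (λ_ (𝟙_ C)).inv ≫ (A ⊗ X') ◁ one ▷ (𝟙_ C) := by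
    rw [MonoidalCategory.tensorHom_def, kunit, whiskerLeft_comp]
  rw [ktensor, e]
  simp only [Category.assoc]
  rw [reassoc_of% h, ← comp_whiskerRight_assoc, MonObj.mul_one, ← MonoidalCategory.tensorHom_def,
    ← tensor_right_unitality, rightUnitor_naturality]

lemma ktensor_braiding {X X' Y Y' : C} (f : X ⟶ A ⊗ X') (g : Y ⟶ A ⊗ Y') :
    ktensor f g ≫ A ◁ (β_ X' Y').hom = (β_ X Y).hom ≫ ktensor g f := by
  have h := tensorμ_braiding A X' A Y'
  have e : (mul : A ⊗ A ⟶ A) ▷ (X' ⊗ Y') ≫ A ◁ (β_ X' Y').hom =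
      ((β_ A A).hom ⊗ₘ (β_ X' Y').hom) ≫ mul ▷ _ := by
    rw [MonoidalCategory.tensorHom_def', Category.assoc, ← comp_whiskerRight,
      IsCommMonObj.mul_comm, MonoidalCategory.whisker_exchange]
  rw [ktensor, ktensor, ← BraidedCategory.braiding_naturality_assoc, ← reassoc_of% h,
    Category.assoc, Category.assoc, e]

end Algebra

/-! ### Vertex sets of composite graphs, and propagation along a connected graph. -/

section Sets

variable {α β I₁ I₂ : Type}

lemma preimage_inl_singleton_inl (a : α) :
    Sum.inl ⁻¹' ({Sum.inl a} : Set (α ⊕ β)) = {a} := by ext; simp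

lemma preimage_inr_singleton_inl (a : α) :
    Sum.inr ⁻¹' ({Sum.inl a} : Set (α ⊕ β)) = ∅ := by ext; simp

lemma preimage_inl_singleton_inr (b : β) :
    Sum.inl ⁻¹' ({Sum.inr b} : Set (α ⊕ β)) = ∅ := by ext; simp

lemma preimage_inr_singleton_inr (b : β) :
    Sum.inr ⁻¹' ({Sum.inr b} : Set (α ⊕ β)) = {b} := by ext; simp

lemma preimage_inl_insert_inl (a : α) (S : Set (α ⊕ β)) :
    Sum.inl ⁻¹' insert (Sum.inl a) S = insert a (Sum.inl ⁻¹' S) := by ext; simp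

lemma preimage_inr_insert_inl (a : α) (S : Set (α ⊕ β)) :
    Sum.inr ⁻¹' insert (Sum.inl a) S = Sum.inr ⁻¹' S := by ext; simp

lemma preimage_inl_insert_inr (b : β) (S : Set (α ⊕ β)) :
    Sum.inl ⁻¹' insert (Sum.inr b) S = Sum.inl ⁻¹' S := by ext; simp

lemma preimage_inr_insert_inr (b : β) (S : Set (α ⊕ β)) :
    Sum.inr ⁻¹' insert (Sum.inr b) S = insert b (Sum.inr ⁻¹' S) := by ext; simp

lemma preimage_inl_union_image_inl (S : Set (α ⊕ β)) (f : I₁ → α) (T : Set I₁) :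
    Sum.inl ⁻¹' (S ∪ (Sum.inl ∘ f) '' T) = Sum.inl ⁻¹' S ∪ f '' T := by ext; simp

lemma preimage_inr_union_image_inl (S : Set (α ⊕ β)) (f : I₁ → α) (T : Set I₁) :
    Sum.inr ⁻¹' (S ∪ (Sum.inl ∘ f) '' T) = Sum.inr ⁻¹' S := by ext; simp

lemma preimage_inl_union_image_inr (S : Set (α ⊕ β)) (f : I₁ → β) (T : Set I₁) :
    Sum.inl ⁻¹' (S ∪ (Sum.inr ∘ f) '' T) = Sum.inl ⁻¹' S := by ext; simp

lemma preimage_inr_union_image_inr (S : Set (α ⊕ β)) (f : I₁ → β) (T : Set I₁) :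
    Sum.inr ⁻¹' (S ∪ (Sum.inr ∘ f) '' T) = Sum.inr ⁻¹' S ∪ f '' T := by ext; simp

lemma preimage_inl_union_image_map (S : Set (α ⊕ β)) (f : I₁ → α) (g : I₂ → β) (T : Set (I₁ ⊕ I₂)) :
    Sum.inl ⁻¹' (S ∪ Sum.map f g '' T) = Sum.inl ⁻¹' S ∪ f '' (Sum.inl ⁻¹' T) := by ext; simp

lemma preimage_inr_union_image_map (S : Set (α ⊕ β)) (f : I₁ → α) (g : I₂ → β) (T : Set (I₁ ⊕ I₂)) :
    Sum.inr ⁻¹' (S ∪ Sum.map f g '' T) = Sum.inr ⁻¹' S ∪ g '' (Sum.inr ⁻¹' T) := by ext; simp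

/-- A function on sets of vertices that does not notice the neighbours of its argument takes the
same value at all nonempty sets of vertices of a finite connected graph. -/
lemma apply_singleton_eq_univ {V : Type} {M : Type*} [Finite V] {G : SimpleGraph V}
    (hG : G.Connected) (F : Set V → M)
    (hF : ∀ v w S, G.Adj v w → v ∈ S → F (insert w S) = F S) (v : V) : F {v} = F Set.univ := by
  have h : ∀ {a b : V} (_ : G.Walk a b) (S : Set V), a ∈ S → F (insert b S) = F S := by
    intro a b p
    induction p with
    | nil => exact fun S hS => by rw [Set.insert_eq_of_mem hS]
    | @cons a c b hac p ih =>
      intro S hS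
      -- The next vertex `c` of the walk is added for free, so that the induction hypothesis applies
      -- to the rest of the walk, and is removed again afterwards.
      rw [← hF a c (insert b S) hac (Or.inr hS), Set.insert_comm, ih _ (Set.mem_insert _ _),
        hF a c S hac hS]
  have h' : ∀ T : Set V, F (T ∪ {v}) = F {v} := by
    intro T
    induction T, T.toFinite using Set.Finite.induction_on with
    | empty => rw [Set.empty_union]
    | @insert b T _ _ ih =>
      obtain ⟨p⟩ := hG.preconnected v b
      rw [Set.insert_union, h p _ (Or.inr rfl), ih]
  rw [← h' Set.univ, Set.univ_union]

end Sets

/-! ### Joining wires to the control wire, discarding it, and the calculus of phases. -/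

section Algebra

variable {C : Type u} [Category.{v} C] [MonoidalCategory C] [SymmetricCategory C]
  [DaggerSymmetricCategory C] {A : C} [ObservableStructure A]

/-- Joining a wire twice is joining it once; this is where `δ† ∘ δ = 1` makes connections
idempotent. -/
lemma comul_kcomp_comul : kcomp (comul : A ⟶ A ⊗ A) comul = comul := by
  rw [kcomp, act, comul_assoc_assoc, Iso.hom_inv_id_assoc, ← comp_whiskerRight, comul_mul,
    id_whiskerRight, Category.comp_id]

lemma ktensor_kunit_right {X X' : C} (f : X ⟶ A ⊗ X') (Y : C) :
    ktensor f (kunit A Y) = f ▷ Y ≫ (α_ A X' Y).hom := by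
  have h := tensorμ_natural (𝟙 A) (𝟙 X') (one : 𝟙_ C ⟶ A) (𝟙 Y)
  simp only [tensorHom_id, id_tensorHom, id_whiskerRight] at h
  have e : (f ⊗ₘ kunit A Y) =
      f ▷ Y ≫ (A ⊗ X') ◁ (λ_ Y).inv ≫ (A ⊗ X') ◁ one ▷ Y := by
    rw [MonoidalCategory.tensorHom_def, kunit, whiskerLeft_comp]
  rw [ktensor, e]
  simp only [Category.assoc]
  rw [reassoc_of% h, ← comp_whiskerRight, MonObj.mul_one]
  simp only [tensorμ, braiding_tensorUnit_right]
  monoidal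

lemma ktensor_kunit_left {X X' : C} (f : X ⟶ A ⊗ X') (Y : C) :
    ktensor (kunit A Y) f =
      (β_ Y X).hom ≫ f ▷ Y ≫ (α_ A X' Y).hom ≫ A ◁ (β_ X' Y).hom := by
  have h := ktensor_braiding f (kunit A Y)
  rw [← cancel_epi (β_ X Y).hom, ← h, ktensor_kunit_right, Category.assoc,
    SymmetricCategory.symmetry_assoc]

/-- Two wires joined to the same control wire are thereby connected, and the Frobenius law fuses
them into one. -/
lemma ktensor_comul_comul :
    ktensor (comul : A ⟶ A ⊗ A) comul = mul ≫ comul ≫ A ◁ comul := by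
  rw [comul_assoc, reassoc_of% @mul_comul_right, ← comp_whiskerRight_assoc, mul_comul_swap, ktensor,
    tensorμ]
  simp [MonoidalCategory.tensorHom_def']

/-- This and the next two lemmas show that a `δ` dot may be joined through either output, through
both or through its input, with the same result. The lemmas that follow them do the same for `δ†`.
-/
lemma comul_ktensor_kunit : (comul : A ⟶ A ⊗ A) ≫ ktensor comul (kunit A A) =
    comul ≫ A ◁ comul := by
  rw [ktensor_kunit_right, comul_assoc]

lemma comul_kunit_ktensor : (comul : A ⟶ A ⊗ A) ≫ ktensor (kunit A A) comul =
    comul ≫ A ◁ comul := by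
  have h := IsCommComonObj.comul_comm A
  have h' := ktensor_braiding (comul : A ⟶ A ⊗ A) (kunit A A)
  rw [← reassoc_of% h, ← h', ← Category.assoc, comul_ktensor_kunit, Category.assoc,
    ← whiskerLeft_comp, h]

lemma comul_ktensor_comul : (comul : A ⟶ A ⊗ A) ≫ ktensor comul comul =
    comul ≫ A ◁ comul := by
  rw [ktensor_comul_comul, reassoc_of% @comul_mul]

lemma ktensor_kunit_mul :
    ktensor (comul : A ⟶ A ⊗ A) (kunit A A) ≫ A ◁ mul = mul ≫ comul := by
  rw [ktensor_kunit_right, Category.assoc, mul_comul_left]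

lemma kunit_ktensor_mul :
    ktensor (kunit A A) (comul : A ⟶ A ⊗ A) ≫ A ◁ mul = mul ≫ comul := by
  have h := IsCommMonObj.mul_comm A
  have h' := ktensor_braiding (kunit A A) (comul : A ⟶ A ⊗ A)
  rw [← h, whiskerLeft_comp, reassoc_of% h', ktensor_kunit_mul, Category.assoc]

lemma ktensor_comul_mul :
    ktensor (comul : A ⟶ A ⊗ A) comul ≫ A ◁ mul = mul ≫ comul := by
  rw [ktensor_comul_comul, Category.assoc, Category.assoc, ← whiskerLeft_comp, comul_mul,
    whiskerLeft_id, Category.comp_id]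

open Classical in
/-- Joining a wire to the control wire if `p` holds. -/
noncomputable def joinIf (A : C) [ObservableStructure A] (p : Prop) : A ⟶ A ⊗ A :=
  if p then comul else kunit A A

lemma joinIf_of_true {p : Prop} (h : p) : joinIf A p = comul := if_pos h

lemma joinIf_of_false {p : Prop} (h : ¬p) : joinIf A p = kunit A A := if_neg h

lemma joinIf_kcomp_joinIf (p q : Prop) : kcomp (joinIf A p) (joinIf A q) = joinIf A (p ∨ q) := by
  by_cases hp : p <;> by_cases hq : q <;>
    simp [joinIf, hp, hq, comul_kcomp_comul]

lemma comul_ktensor_joinIf (p q : Prop) :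
    (comul : A ⟶ A ⊗ A) ≫ ktensor (joinIf A p) (joinIf A q) =
      joinIf A (p ∨ q) ≫ A ◁ comul := by
  by_cases hp : p <;> by_cases hq : q <;>
    simp [joinIf, hp, hq, comul_ktensor_comul, comul_ktensor_kunit, comul_kunit_ktensor,
      kunit_naturality]

lemma ktensor_joinIf_mul (p q : Prop) :
    ktensor (joinIf A p) (joinIf A q) ≫ A ◁ mul = mul ≫ joinIf A (p ∨ q) := by
  by_cases hp : p <;> by_cases hq : q <;>
    simp [joinIf, hp, hq, ktensor_comul_mul, ktensor_kunit_mul, kunit_ktensor_mul,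
      kunit_naturality]

/-- Discarding the control wire. -/
def cap {X Y : C} (f : X ⟶ A ⊗ Y) : X ⟶ Y := f ≫ counit ▷ Y ≫ (λ_ Y).hom

lemma cap_whiskerLeft {X Y Z : C} (f : X ⟶ A ⊗ Y) (g : Y ⟶ Z) :
    cap (f ≫ A ◁ g) = cap f ≫ g := by
  simp only [cap, Category.assoc, MonoidalCategory.whisker_exchange_assoc, leftUnitor_naturality]

lemma comp_cap {X Y Z : C} (f : X ⟶ Y) (g : Y ⟶ A ⊗ Z) : cap (f ≫ g) = f ≫ cap g := by
  simp [cap]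

lemma cap_comul : cap (comul : A ⟶ A ⊗ A) = 𝟙 A := by
  rw [cap, counit_comul_assoc, Iso.inv_hom_id]

lemma cap_ktensor_kunit {X X' : C} (f : X ⟶ A ⊗ X') (Y : C) :
    cap (ktensor f (kunit A Y)) = cap f ▷ Y := by
  simp [ktensor_kunit_right, cap]

lemma cap_kunit_ktensor {X X' : C} (f : X ⟶ A ⊗ X') (Y : C) :
    cap (ktensor (kunit A Y) f) = Y ◁ cap f := by
  have h := cap_ktensor_kunit f Y
  rw [ktensor_kunit_right] at h
  rw [ktensor_kunit_left, ← Category.assoc (f ▷ Y), comp_cap, cap_whiskerLeft, h,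
    ← braiding_naturality_right_assoc, SymmetricCategory.symmetry, Category.comp_id]

/-- By associativity, `phase ψ` is linear over `A`; all other rules for phases come from this. -/
lemma phase_mul (ψ : 𝟙_ C ⟶ A) : phase ψ ▷ A ≫ mul = mul ≫ phase ψ := by
  have h : (λ_ (A ⊗ A)).inv ≫ (α_ (𝟙_ C) A A).inv = (λ_ A).inv ▷ A := by simp
  rw [phase, dagger_comul, comp_whiskerRight, comp_whiskerRight, Category.assoc, Category.assoc,
    leftUnitor_inv_naturality_assoc, MonoidalCategory.whisker_exchange_assoc,
    MonObj.mul_assoc_flip, associator_inv_naturality_left_assoc, reassoc_of% h]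

lemma mul_phase (ψ : 𝟙_ C ⟶ A) : A ◁ phase ψ ≫ mul = mul ≫ phase ψ := by
  have h := IsCommMonObj.mul_comm A
  rw [← h, braiding_naturality_right_assoc, phase_mul, Category.assoc]

lemma phase_comm (ψ φ : 𝟙_ C ⟶ A) : phase ψ ≫ phase φ = phase φ ≫ phase ψ := by
  rw [phase, dagger_comul, Category.assoc, Category.assoc, ← mul_phase,
    ← MonoidalCategory.whisker_exchange_assoc, ← leftUnitor_inv_naturality_assoc]

/-- The point `ψ ⊙ φ` is `φ ≫ phase ψ`, and `phase ψ` moves out of the multiplication by linearity.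
-/
lemma phase_pointMul (ψ φ : 𝟙_ C ⟶ A) : phase (pointMul ψ φ) = phase φ ≫ phase ψ := by
  have h : pointMul ψ φ = φ ≫ phase ψ := by
    rw [pointMul, phase, dagger_comul, MonoidalCategory.tensorHom_def', Category.assoc,
      leftUnitor_inv_naturality_assoc]
  rw [h]
  change (λ_ A).inv ≫ (φ ≫ phase ψ) ▷ A ≫ mul = ((λ_ A).inv ≫ φ ▷ A ≫ mul) ≫ phase ψ
  rw [comp_whiskerRight_assoc, phase_mul]
  simp only [Category.assoc]

lemma phase_one : phase (one : 𝟙_ C ⟶ A) = 𝟙 A := by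
  rw [phase, dagger_comul, MonObj.one_mul, Iso.inv_hom_id]

lemma one_phase (ψ : 𝟙_ C ⟶ A) : one ≫ phase ψ = ψ := by
  rw [phase, dagger_comul, leftUnitor_inv_naturality_assoc,
    MonoidalCategory.whisker_exchange_assoc, MonObj.mul_one]
  simp [unitors_inv_equal]

lemma phase_pointProd_append (l l' : List (𝟙_ C ⟶ A)) :
    phase (pointProd (l ++ l')) = phase (pointProd l) ≫ phase (pointProd l') := by
  induction l with
  | nil => rw [List.nil_append, pointProd, dagger_counit, phase_one, Category.id_comp]
  | cons ψ l ih =>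
    rw [List.cons_append, pointProd, pointProd, phase_pointMul, phase_pointMul, ih,
      Category.assoc, Category.assoc, phase_comm ψ]

lemma kunit_unit : kunit A (𝟙_ C) = one ≫ comul ≫ A ◁ counit := by
  rw [comul_counit, rightUnitor_inv_naturality, kunit, unitors_inv_equal]

/-- A comultiplication followed by two arms that the multiplication absorbs is absorbed as well. -/
lemma comul_conv_mul {X Y : C} {s : A ⟶ X} {m : X ⟶ A} {s' : A ⟶ Y} {m' : Y ⟶ A}
    (h : (comul : A ⟶ A ⊗ A) ≫ A ◁ (s ≫ m) ≫ mul = 𝟙 A)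
    (h' : (comul : A ⟶ A ⊗ A) ≫ A ◁ (s' ≫ m') ≫ mul = 𝟙 A) :
    (comul : A ⟶ A ⊗ A) ≫ A ◁ ((comul ≫ (s ⊗ₘ s')) ≫ (m ⊗ₘ m') ≫ mul) ≫ mul = 𝟙 A := by
  have e : (comul ≫ (s ⊗ₘ s')) ≫ (m ⊗ₘ m') ≫ (mul : A ⊗ A ⟶ A) =
      comul ≫ ((s ≫ m) ⊗ₘ (s' ≫ m')) ≫ mul := by
    rw [← tensorHom_comp_tensorHom]
    simp only [Category.assoc]
  rw [e]
  generalize s ≫ m = p at *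
  generalize s' ≫ m' = q at *
  have e' : A ◁ (comul ≫ (p ⊗ₘ q) ≫ mul) ≫ (mul : A ⊗ A ⟶ A) =
      A ◁ comul ≫ (α_ A A A).inv ≫ ((A ◁ p ≫ mul) ⊗ₘ q) ≫ mul := by
    rw [whiskerLeft_comp_assoc, whiskerLeft_comp_assoc, MonObj.mul_assoc_flip,
      MonoidalCategory.tensorHom_def', MonoidalCategory.tensorHom_def', whiskerLeft_comp_assoc,
      associator_inv_naturality_middle_assoc, associator_inv_naturality_right_assoc,
      comp_whiskerRight, Category.assoc, Category.assoc]
  rw [e', comul_assoc_assoc, Iso.hom_inv_id_assoc, MonoidalCategory.tensorHom_def, Category.assoc,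
    ← comp_whiskerRight_assoc, h, id_whiskerRight, Category.id_comp, h']

/-- Two normal forms side by side become a single one, since they share the control wire. -/
lemma ktensor_merge_split {X X' Y Y' : C} (m : X ⟶ A) (m' : X' ⟶ A) (s : A ⟶ Y) (s' : A ⟶ Y') :
    ktensor (m ≫ comul ≫ A ◁ s) (m' ≫ comul ≫ A ◁ s') =
      ((m ⊗ₘ m') ≫ mul) ≫ comul ≫ A ◁ (comul ≫ (s ⊗ₘ s')) := by
  rw [comp_ktensor, ktensor_whiskerLeft, ktensor_comul_comul, whiskerLeft_comp]
  simp only [Category.assoc]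

end Algebra

/-! ### Bundles of wires: splitting, merging and joining to the control wire. -/

section Words

variable {C : Type u} [Category.{v} C] [MonoidalCategory C] [SymmetricCategory C]
  [DaggerSymmetricCategory C] (A : C) [ObservableStructure A]

/-- The comultiplication from `A` to the wires of a word. -/
def split : (X : Word) → (A ⟶ X.eval A)
  | Word.unit => (counit : A ⟶ 𝟙_ C)
  | Word.obj => 𝟙 A
  | Word.tensor X Y => (comul : A ⟶ A ⊗ A) ≫ (split X ⊗ₘ split Y)

/-- The multiplication of all wires of a word. -/
def merge (X : Word) : X.eval A ⟶ A := dagger (split A X)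

lemma merge_obj : merge A Word.obj = 𝟙 A := DaggerSymmetricCategory.dagger_id A

lemma merge_tensor (X Y : Word) :
    merge A (Word.tensor X Y) = (merge A X ⊗ₘ merge A Y) ≫ mul := by
  exact (DaggerSymmetricCategory.dagger_comp _ _).trans
    (congrArg (· ≫ mul) (DaggerSymmetricCategory.dagger_tensor _ _))

lemma copy_eq_split : ∀ n : ℕ, copy A n = split A (Word.pow n)
  | 0 => rfl
  | 1 => rfl
  | n + 2 => by
    rw [copy, copy_eq_split (n + 1)]
    exact congrArg (comul ≫ ·) (tensorHom_id _ _).symm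

/-- Between two parts of a diagram that share the control wire, the connecting wires are redundant.
The parallel control wire is essential: for the empty word `split` followed by `merge` is `ε† ∘ ε`,
which need not be the identity. -/
lemma comul_split_merge_mul (X : Word) :
    (comul : A ⟶ A ⊗ A) ≫ A ◁ (split A X ≫ merge A X) ≫ mul = 𝟙 A := by
  induction X with
  | unit =>
    have h : (comul : A ⟶ A ⊗ A) ≫ A ◁ (counit ≫ one) ≫ mul = 𝟙 A := by
      rw [whiskerLeft_comp_assoc, comul_counit_assoc, MonObj.mul_one, Iso.inv_hom_id]
    exact h
  | obj =>
    have h : (comul : A ⟶ A ⊗ A) ≫ A ◁ (𝟙 A ≫ 𝟙 A) ≫ mul = 𝟙 A := by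
      rw [Category.comp_id, whiskerLeft_id, Category.id_comp, comul_mul]
    rw [merge_obj]
    exact h
  | tensor X Y hX hY =>
    rw [merge_tensor]
    exact comul_conv_mul hX hY

/-- Joining the wires in `S` to the control wire. -/
noncomputable def att : (X : Word) → Set X.Wires → (X.eval A ⟶ A ⊗ X.eval A)
  | Word.unit, _ => kunit A (𝟙_ C)
  | Word.obj, S => joinIf A (() ∈ S)
  | Word.tensor X Y, S => ktensor (att X (Sum.inl ⁻¹' S)) (att Y (Sum.inr ⁻¹' S))

lemma att_empty (X : Word) : att A X ∅ = kunit A (X.eval A) := by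
  induction X with
  | unit => rfl
  | obj => exact joinIf_of_false (Set.notMem_empty ())
  | tensor X Y hX hY =>
    exact (congrArg₂ ktensor hX hY).trans (ktensor_kunit _ _)

lemma att_kcomp_att (X : Word) (S T : Set X.Wires) :
    kcomp (att A X S) (att A X T) = att A X (S ∪ T) := by
  induction X with
  | unit => exact kcomp_kunit _
  | obj => exact joinIf_kcomp_joinIf _ _
  | tensor X Y hX hY =>
    exact (ktensor_kcomp _ _ _ _).trans (congrArg₂ ktensor (hX _ _) (hY _ _))

lemma att_univ (X : Word) : att A X Set.univ = merge A X ≫ comul ≫ A ◁ split A X := by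
  induction X with
  | unit => exact kunit_unit
  | obj =>
    have h : (comul : A ⟶ A ⊗ A) = 𝟙 A ≫ comul ≫ A ◁ 𝟙 A := by simp
    rw [merge_obj]
    exact (joinIf_of_true (Set.mem_univ ())).trans h
  | tensor X Y hX hY =>
    rw [merge_tensor]
    exact (congrArg₂ ktensor hX hY).trans (ktensor_merge_split _ _ _ _)

/-- The counit law removes the single connection. With no connection at all, a scalar `ε ∘ ε†` would
remain. -/
lemma cap_att_singleton (X : Word) (x : X.Wires) : cap (att A X {x}) = 𝟙 (X.eval A) := by
  induction X with
  | unit => exact x.elim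
  | obj => exact (congrArg cap (joinIf_of_true (Set.mem_singleton ()))).trans cap_comul
  | tensor X Y hX hY =>
    rcases x with x | y
    · have h : cap (ktensor (att A X (Sum.inl ⁻¹' ({Sum.inl x} : Set (X.Wires ⊕ Y.Wires))))
          (att A Y (Sum.inr ⁻¹' ({Sum.inl x} : Set (X.Wires ⊕ Y.Wires))))) =
            𝟙 (X.eval A ⊗ Y.eval A) := by
        rw [preimage_inl_singleton_inl, preimage_inr_singleton_inl, att_empty,
          cap_ktensor_kunit, hX, id_whiskerRight]
      exact h
    · have h : cap (ktensor (att A X (Sum.inl ⁻¹' ({Sum.inr y} : Set (X.Wires ⊕ Y.Wires))))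
          (att A Y (Sum.inr ⁻¹' ({Sum.inr y} : Set (X.Wires ⊕ Y.Wires))))) =
            𝟙 (X.eval A ⊗ Y.eval A) := by
        rw [preimage_inl_singleton_inr, preimage_inr_singleton_inr, att_empty,
          cap_kunit_ktensor, hY, whiskerLeft_id]
      exact h

end Words

instance finite_wires : (X : Word) → Finite X.Wires
  | Word.unit => inferInstanceAs (Finite Empty)
  | Word.obj => inferInstanceAs (Finite Unit)
  | Word.tensor X Y =>
    have := finite_wires X
    have := finite_wires Y
    inferInstanceAs (Finite (X.Wires ⊕ Y.Wires))

/-- Hence a set of vertices of a generator is the same as a set of its input wires, and `ctl` can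
join vertices through their inputs. -/
lemma Gen.input_bijective {X Y : Word} (g : Gen X Y) : Function.Bijective g.graph.input := by
  cases g
  case comul => exact (Equiv.refl Unit).bijective
  case counit => exact (Equiv.refl Unit).bijective
  all_goals exact Function.bijective_id

lemma Gen.graph_eq_bot {X Y : Word} (g : Gen X Y) : g.graph.graph = ⊥ := by
  cases g <;> rfl

/-! ### Controlled diagrams: sliding connections, and the normal form. -/

section Diagrams

/-- This transfers `att_comp_gen` from a structure map to its adjoint, which is its inverse. -/
lemma whiskerLeft_inverse {C : Type u} [Category.{v} C] [MonoidalCategory C] {A X Y : C}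
    {θ : X ⟶ Y} {θ' : Y ⟶ X} (h₁ : θ' ≫ θ = 𝟙 Y)
    (h₂ : θ ≫ θ' = 𝟙 X) {a : X ⟶ A ⊗ X} {b : Y ⟶ A ⊗ Y} (h : a ≫ A ◁ θ = θ ≫ b) :
    b ≫ A ◁ θ' = θ' ≫ a := by
  have := congrArg (fun t => θ' ≫ t ≫ A ◁ θ') h
  simpa only [Category.assoc, ← whiskerLeft_comp, h₂, whiskerLeft_id, Category.comp_id,
    reassoc_of% h₁] using this.symm

variable {C : Type u} [Category.{v} C] [MonoidalCategory C] [SymmetricCategory C]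
  [DaggerSymmetricCategory C] {A : C} [ObservableStructure A]

lemma mem_input_comul (T : Set (Word.tensor Word.obj Word.obj).Wires) :
    (() ∈ Gen.comul.graph.input ⁻¹' (Gen.comul.graph.output '' T)) =
      (Sum.inl () ∈ T ∨ Sum.inr () ∈ T) := by
  refine propext ⟨?_, fun h => h.elim (fun h => ⟨_, h, rfl⟩) (fun h => ⟨_, h, rfl⟩)⟩
  rintro ⟨⟨⟩ | ⟨⟩, h, -⟩
  exacts [Or.inl h, Or.inr h]

/-- Connections on outputs slide back to the inputs that share a vertex with them. -/
lemma att_comp_gen {X Y : Word} (g : Gen X Y) : ∀ T : Set Y.Wires,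
    att A X (g.graph.input ⁻¹' (g.graph.output '' T)) ≫ A ◁ g.eval A =
      g.eval A ≫ att A Y T := by
  cases g with
  | comul =>
    intro T
    have h : (() ∈ Gen.comul.graph.input ⁻¹' (Gen.comul.graph.output '' T)) =
        (Sum.inl () ∈ T ∨ Sum.inr () ∈ T) := mem_input_comul T
    exact (congrArg (joinIf A · ≫ A ◁ (comul : A ⟶ A ⊗ A)) h).trans
      (comul_ktensor_joinIf _ _).symm
  | counit =>
    intro T
    have h : () ∉ Gen.counit.graph.input ⁻¹' (Gen.counit.graph.output '' T) :=
      fun ⟨t, _⟩ => t.elim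
    exact (congrArg (· ≫ A ◁ (counit : A ⟶ 𝟙_ C)) (joinIf_of_false h)).trans
      (kunit_naturality _).symm
  | associator X Y Z =>
    intro T
    have h : id ⁻¹' ((Equiv.sumAssoc X.Wires Y.Wires Z.Wires).symm '' T) =
      Equiv.sumAssoc X.Wires Y.Wires Z.Wires ⁻¹' T := Equiv.image_symm_eq_preimage _ _
    exact (congrArg (att A (((X.tensor Y).tensor Z)) · ≫ A ◁ (α_ _ _ _).hom) h).trans
      (ktensor_associator _ _ _)
  | leftUnitor =>
    intro T
    have h : id ⁻¹' ((Equiv.emptySum Empty Y.Wires).symm '' T) =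
      Equiv.emptySum Empty Y.Wires ⁻¹' T := Equiv.image_symm_eq_preimage _ _
    exact (congrArg (att A (Word.unit.tensor Y) · ≫ A ◁ (λ_ _).hom) h).trans
      (ktensor_leftUnitor _)
  | rightUnitor =>
    intro T
    have h : id ⁻¹' ((Equiv.sumEmpty Y.Wires Empty).symm '' T) =
      Equiv.sumEmpty Y.Wires Empty ⁻¹' T := Equiv.image_symm_eq_preimage _ _
    exact (congrArg (att A (Y.tensor Word.unit) · ≫ A ◁ (ρ_ _).hom) h).trans
      (ktensor_rightUnitor _)
  | braiding X Y =>
    intro T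
    have h : id ⁻¹' ((Equiv.sumComm X.Wires Y.Wires).symm '' T) =
      Equiv.sumComm X.Wires Y.Wires ⁻¹' T := Equiv.image_symm_eq_preimage _ _
    exact (congrArg (att A (X.tensor Y) · ≫ A ◁ (β_ _ _).hom) h).trans
      (ktensor_braiding _ _)

lemma att_comp_dagger_gen {X Y : Word} (g : Gen X Y) : ∀ T : Set Y.Wires,
    att A Y T ≫ A ◁ dagger (g.eval A) =
      dagger (g.eval A) ≫ att A X (g.graph.input ⁻¹' (g.graph.output '' T)) := by
  cases g with
  | comul =>
    intro T
    have h : (() ∈ Gen.comul.graph.input ⁻¹' (Gen.comul.graph.output '' T)) =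
        (Sum.inl () ∈ T ∨ Sum.inr () ∈ T) := mem_input_comul T
    exact (ktensor_joinIf_mul _ _).trans
      (congrArg ((mul : A ⊗ A ⟶ A) ≫ joinIf A ·) h.symm)
  | counit =>
    intro T
    have h : () ∉ Gen.counit.graph.input ⁻¹' (Gen.counit.graph.output '' T) :=
      fun ⟨t, _⟩ => t.elim
    exact (kunit_naturality _).symm.trans
      (congrArg ((one : 𝟙_ C ⟶ A) ≫ ·) (joinIf_of_false h).symm)
  | associator X Y Z =>
    intro T
    have e := DaggerSymmetricCategory.dagger_associator (X.eval A) (Y.eval A) (Z.eval A)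
    refine whiskerLeft_inverse ?_ ?_ (att_comp_gen _ T)
    · exact (congrArg (· ≫ (α_ _ _ _).hom) e).trans (Iso.inv_hom_id _)
    · exact (congrArg ((α_ _ _ _).hom ≫ ·) e).trans (Iso.hom_inv_id _)
  | leftUnitor =>
    intro T
    have e := DaggerSymmetricCategory.dagger_leftUnitor (Y.eval A)
    refine whiskerLeft_inverse ?_ ?_ (att_comp_gen _ T)
    · exact (congrArg (· ≫ (λ_ _).hom) e).trans (Iso.inv_hom_id _)
    · exact (congrArg ((λ_ _).hom ≫ ·) e).trans (Iso.hom_inv_id _)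
  | rightUnitor =>
    intro T
    have e := DaggerSymmetricCategory.dagger_rightUnitor (Y.eval A)
    refine whiskerLeft_inverse ?_ ?_ (att_comp_gen _ T)
    · exact (congrArg (· ≫ (ρ_ _).hom) e).trans (Iso.inv_hom_id _)
    · exact (congrArg ((ρ_ _).hom ≫ ·) e).trans (Iso.hom_inv_id _)
  | braiding X Y =>
    intro T
    have e := DaggerSymmetricCategory.dagger_braiding (X.eval A) (Y.eval A)
    refine whiskerLeft_inverse ?_ ?_ (att_comp_gen _ T)
    · exact (congrArg (· ≫ (β_ _ _).hom) e).trans (Iso.inv_hom_id _)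
    · exact (congrArg ((β_ _ _).hom ≫ ·) e).trans (Iso.hom_inv_id _)

/-- The morphism that a diagram denotes if the vertices in `S` are joined to a control wire. -/
noncomputable def ctl : {X Y : Word} → (D : Diagram A X Y) → Set D.graph.V →
    (X.eval A ⟶ A ⊗ Y.eval A)
  | _, _, Diagram.id X, S => att A X S
  | X, _, Diagram.gen g, S => att A X (g.graph.input ⁻¹' S) ≫ A ◁ g.eval A
  | _, Y, Diagram.genDagger g, S => dagger (g.eval A) ≫ att A Y (g.graph.input ⁻¹' S)
  -- A point has no input, so its dot is joined through the output.
  | _, _, Diagram.point ψ, S => ψ ≫ att A Word.obj ((Diagram.point ψ).graph.output ⁻¹' S)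
  | _, _, Diagram.comp D E, S => kcomp (ctl D (Sum.inl ⁻¹' S)) (ctl E (Sum.inr ⁻¹' S))
  | _, _, Diagram.tensor D E, S => ktensor (ctl D (Sum.inl ⁻¹' S)) (ctl E (Sum.inr ⁻¹' S))

instance finite_vertices : {X Y : Word} → (D : Diagram A X Y) → Finite D.graph.V
  | _, _, Diagram.id X => finite_wires X
  | _, _, Diagram.gen g => Finite.of_surjective _ g.input_bijective.2
  | _, _, Diagram.genDagger g => Finite.of_surjective _ g.input_bijective.2
  | _, _, Diagram.point _ => inferInstanceAs (Finite Unit)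
  | _, _, Diagram.comp D E =>
    have := finite_vertices D
    have := finite_vertices E
    inferInstanceAs (Finite (D.graph.V ⊕ E.graph.V))
  | _, _, Diagram.tensor D E =>
    have := finite_vertices D
    have := finite_vertices E
    inferInstanceAs (Finite (D.graph.V ⊕ E.graph.V))

lemma ctl_kcomp_att {X Y : Word} (D : Diagram A X Y) (S : Set D.graph.V) (T : Set Y.Wires) :
    kcomp (ctl D S) (att A Y T) = ctl D (S ∪ D.graph.output '' T) := by
  induction D with
  | id X =>
    exact (att_kcomp_att A X S T).trans
      (congrArg (fun U => att A X (S ∪ U)) (Set.image_id T).symm)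
  | gen g =>
    have h : ∀ S : Set g.graph.V,
        kcomp (att A _ (g.graph.input ⁻¹' S) ≫ A ◁ g.eval A) (att A _ T) =
        att A _ (g.graph.input ⁻¹' (S ∪ g.graph.output '' T)) ≫ A ◁ g.eval A := by
      intro S
      rw [whiskerLeft_kcomp, ← att_comp_gen, kcomp_whiskerLeft, att_kcomp_att,
        Set.preimage_union]
    exact h S
  | genDagger g =>
    have h : ∀ S : Set g.graph.V,
        kcomp (dagger (g.eval A) ≫ att A _ (g.graph.input ⁻¹' S)) (att A _ T) =
        dagger (g.eval A) ≫ att A _ (g.graph.input ⁻¹' (S ∪ g.graph.input '' T)) := by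
      intro S
      rw [comp_kcomp, att_kcomp_att, Set.preimage_union,
        Set.preimage_image_eq _ g.input_bijective.1]
    exact h S
  | point ψ =>
    have h : ∀ S T : Set Word.obj.Wires, kcomp (ψ ≫ att A Word.obj S) (att A Word.obj T) =
        ψ ≫ att A Word.obj (S ∪ T) := fun S T => by rw [← att_kcomp_att]; exact comp_kcomp _ _ _
    exact (h S T).trans (congrArg (fun U : Set Word.obj.Wires => ψ ≫ att A Word.obj (S ∪ U))
      (Set.image_id T).symm)
  | comp D E ihD ihE =>
    refine (kcomp_assoc _ _ _).trans (congrArg₂ kcomp (congrArg _ ?_) ((ihE _ _).trans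
      (congrArg _ ?_)))
    · exact (preimage_inl_union_image_inr S E.graph.output T).symm
    · exact (preimage_inr_union_image_inr S E.graph.output T).symm
  | tensor D E ihD ihE =>
    refine (ktensor_kcomp _ _ _ _).trans (congrArg₂ ktensor ((ihD _ _).trans (congrArg _ ?_))
      ((ihE _ _).trans (congrArg _ ?_)))
    · exact (preimage_inl_union_image_map S D.graph.output E.graph.output T).symm
    · exact (preimage_inr_union_image_map S D.graph.output E.graph.output T).symm

lemma att_kcomp_ctl {X Y : Word} (D : Diagram A X Y) (S : Set D.graph.V) (T : Set X.Wires) :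
    kcomp (att A X T) (ctl D S) = ctl D (S ∪ D.graph.input '' T) := by
  induction D with
  | id X =>
    exact (att_kcomp_att A X T S).trans
      (congrArg (att A X) ((Set.union_comm T S).trans (congrArg (S ∪ ·) (Set.image_id T).symm)))
  | gen g =>
    have h : ∀ S : Set g.graph.V,
        kcomp (att A _ T) (att A _ (g.graph.input ⁻¹' S) ≫ A ◁ g.eval A) =
        att A _ (g.graph.input ⁻¹' (S ∪ g.graph.input '' T)) ≫ A ◁ g.eval A := by
      intro S
      rw [kcomp_whiskerLeft, att_kcomp_att, Set.preimage_union,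
        Set.preimage_image_eq _ g.input_bijective.1, Set.union_comm]
    exact h S
  | genDagger g =>
    have h : ∀ S : Set g.graph.V,
        kcomp (att A _ T) (dagger (g.eval A) ≫ att A _ (g.graph.input ⁻¹' S)) =
        dagger (g.eval A) ≫ att A _ (g.graph.input ⁻¹' (S ∪ g.graph.output '' T)) := by
      intro S
      rw [← whiskerLeft_kcomp, att_comp_dagger_gen, comp_kcomp, att_kcomp_att,
        Set.preimage_union, Set.union_comm]
    exact h S
  | point ψ =>
    have h : (Diagram.point ψ).graph.input '' T = ∅ :=
      Set.eq_empty_of_forall_notMem fun _ ⟨t, _⟩ => t.elim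
    rw [h, Set.union_empty]
    exact kunit_kcomp _
  | comp D E ihD ihE =>
    refine (kcomp_assoc _ _ _).symm.trans (congrArg₂ kcomp ((ihD _ _).trans
      (congrArg _ ?_)) (congrArg _ ?_))
    · exact (preimage_inl_union_image_inl S D.graph.input T).symm
    · exact (preimage_inr_union_image_inl S D.graph.input T).symm
  | tensor D E ihD ihE =>
    refine (ktensor_kcomp _ _ _ _).trans (congrArg₂ ktensor ((ihD _ _).trans (congrArg _ ?_))
      ((ihE _ _).trans (congrArg _ ?_)))
    · exact (preimage_inl_union_image_map S D.graph.input E.graph.input T).symm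
    · exact (preimage_inr_union_image_map S D.graph.input E.graph.input T).symm

/-- Both sides join the boundary wire `k` itself; associativity of `kcomp` assigns this connection
to either part. -/
lemma ctl_kcomp_ctl_insert {X Y Z : Word} (D : Diagram A X Y) (E : Diagram A Y Z)
    (S : Set D.graph.V) (T : Set E.graph.V) (k : Y.Wires) :
    kcomp (ctl D S) (ctl E (insert (E.graph.input k) T)) =
      kcomp (ctl D (insert (D.graph.output k) S)) (ctl E T) := by
  rw [← Set.union_singleton, ← Set.union_singleton, ← Set.image_singleton, ← Set.image_singleton,
    ← ctl_kcomp_att, ← att_kcomp_ctl, kcomp_assoc]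

/-- Only composition creates edges, one for each boundary wire. The connection at one end of such an
edge moves to the other end, which is already joined. -/
lemma ctl_insert_of_adj {X Y : Word} (D : Diagram A X Y) (v w : D.graph.V) (S : Set D.graph.V)
    (hvw : D.graph.graph.Adj v w) (hv : v ∈ S) : ctl D (insert w S) = ctl D S := by
  induction D with
  | id X => exact hvw.elim
  | gen g =>
    change g.graph.graph.Adj v w at hvw
    rw [g.graph_eq_bot] at hvw
    exact hvw.elim
  | genDagger g =>
    change g.graph.graph.Adj v w at hvw
    rw [g.graph_eq_bot] at hvw
    exact hvw.elim
  | point ψ => exact hvw.elim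
  | comp D E ihD ihE =>
    rcases v with a | a <;> rcases w with b | b
    · have h : D.graph.graph.Adj a b := by
        simpa [Diagram.graph, OpenGraph.comp] using hvw
      exact congrArg₂ kcomp ((congrArg _ (preimage_inl_insert_inl b S)).trans (ihD a b _ h hv))
        (congrArg _ (preimage_inr_insert_inl b S))
    · have h : ∃ k, a = D.graph.output k ∧ b = E.graph.input k := by
        simpa [Diagram.graph, OpenGraph.comp] using hvw
      obtain ⟨k, rfl, rfl⟩ := h
      refine (congrArg₂ kcomp (congrArg _ (preimage_inl_insert_inr _ S))
        (congrArg _ (preimage_inr_insert_inr _ S))).trans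
          ((ctl_kcomp_ctl_insert D E _ _ k).trans ?_)
      exact congrArg₂ kcomp (congrArg _ (Set.insert_eq_of_mem hv)) rfl
    · have h : ∃ k, b = D.graph.output k ∧ a = E.graph.input k := by
        simpa [Diagram.graph, OpenGraph.comp] using hvw
      obtain ⟨k, rfl, rfl⟩ := h
      refine (congrArg₂ kcomp (congrArg _ (preimage_inl_insert_inl _ S))
        (congrArg _ (preimage_inr_insert_inl _ S))).trans
          ((ctl_kcomp_ctl_insert D E _ _ k).symm.trans ?_)
      exact congrArg₂ kcomp rfl (congrArg _ (Set.insert_eq_of_mem hv))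
    · have h : E.graph.graph.Adj a b := by
        simpa [Diagram.graph, OpenGraph.comp] using hvw
      exact congrArg₂ kcomp (congrArg _ (preimage_inl_insert_inr b S))
        ((congrArg _ (preimage_inr_insert_inr b S)).trans (ihE a b _ h hv))
  | tensor D E ihD ihE =>
    rcases v with a | a <;> rcases w with b | b
    · exact congrArg₂ ktensor
        ((congrArg _ (preimage_inl_insert_inl b S)).trans (ihD a b _ hvw hv))
        (congrArg _ (preimage_inr_insert_inl b S))
    · exact (Bool.false_ne_true hvw).elim
    · exact (Bool.false_ne_true hvw).elim
    · exact congrArg₂ ktensor (congrArg _ (preimage_inl_insert_inr b S))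
        ((congrArg _ (preimage_inr_insert_inr b S)).trans (ihE a b _ hvw hv))

lemma ctl_empty {X Y : Word} (D : Diagram A X Y) : ctl D ∅ = D.eval ≫ kunit A (Y.eval A) := by
  induction D with
  | id X => exact (att_empty A X).trans (Category.id_comp _).symm
  | gen g =>
    have h : att A _ (g.graph.input ⁻¹' ∅) ≫ A ◁ g.eval A = g.eval A ≫ kunit A _ := by
      rw [Set.preimage_empty, att_empty, kunit_naturality]
    exact h
  | genDagger g => exact congrArg (dagger (g.eval A) ≫ ·) (att_empty A _)
  | point ψ => exact congrArg (ψ ≫ ·) (att_empty A Word.obj)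
  | comp D E ihD ihE =>
    have h : kcomp (D.eval ≫ kunit A _) (E.eval ≫ kunit A _) =
        (D.eval ≫ E.eval) ≫ kunit A _ := by
      rw [comp_kcomp, kunit_kcomp, Category.assoc]
    exact (congrArg₂ kcomp ihD ihE).trans h
  | tensor D E ihD ihE =>
    have h : ktensor (D.eval ≫ kunit A _) (E.eval ≫ kunit A _) =
        (D.eval ⊗ₘ E.eval) ≫ kunit A _ := by
      rw [comp_ktensor, ktensor_kunit]
    exact (congrArg₂ ktensor ihD ihE).trans h

lemma cap_ctl_singleton {X Y : Word} (D : Diagram A X Y) (v : D.graph.V) :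
    cap (ctl D {v}) = D.eval := by
  induction D with
  | id X => exact cap_att_singleton A X v
  | gen g =>
    obtain ⟨x, rfl⟩ := g.input_bijective.2 v
    have h : cap (att A _ (g.graph.input ⁻¹' {g.graph.input x}) ≫ A ◁ g.eval A) = g.eval A := by
      rw [← Set.image_singleton, Set.preimage_image_eq _ g.input_bijective.1, cap_whiskerLeft,
        cap_att_singleton, Category.id_comp]
    exact h
  | genDagger g =>
    obtain ⟨x, rfl⟩ := g.input_bijective.2 v
    have h : cap (dagger (g.eval A) ≫ att A _ (g.graph.input ⁻¹' {g.graph.input x})) =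
        dagger (g.eval A) := by
      rw [← Set.image_singleton, Set.preimage_image_eq _ g.input_bijective.1, comp_cap,
        cap_att_singleton, Category.comp_id]
    exact h
  | point ψ =>
    exact (comp_cap _ _).trans ((congrArg (ψ ≫ ·) (cap_att_singleton A Word.obj v)).trans
      (Category.comp_id _))
  | comp D E ihD ihE =>
    rcases v with v | v
    · refine (congrArg cap (congrArg₂ kcomp (congrArg _ (preimage_inl_singleton_inl v))
        ((congrArg _ (preimage_inr_singleton_inl v)).trans (ctl_empty E)))).trans ?_
      have h : cap (kcomp (ctl D {v}) (E.eval ≫ kunit A _)) = D.eval ≫ E.eval := by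
        rw [kunit_naturality, kcomp_whiskerLeft, kcomp_kunit, cap_whiskerLeft, ihD]
      exact h
    · refine (congrArg cap (congrArg₂ kcomp ((congrArg _ (preimage_inl_singleton_inr v)).trans
        (ctl_empty D)) (congrArg _ (preimage_inr_singleton_inr v)))).trans ?_
      have h : cap (kcomp (D.eval ≫ kunit A _) (ctl E {v})) = D.eval ≫ E.eval := by
        rw [comp_kcomp, kunit_kcomp, comp_cap, ihE]
      exact h
  | tensor D E ihD ihE =>
    rcases v with v | v
    · refine (congrArg cap (congrArg₂ ktensor (congrArg _ (preimage_inl_singleton_inl v))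
        ((congrArg _ (preimage_inr_singleton_inl v)).trans (ctl_empty E)))).trans ?_
      have h : cap (ktensor (ctl D {v}) (E.eval ≫ kunit A _)) = D.eval ⊗ₘ E.eval := by
        rw [← Category.id_comp (ctl D {v}), comp_ktensor, comp_cap, cap_ktensor_kunit, ihD,
          ← tensorHom_id, tensorHom_comp_tensorHom, Category.id_comp, Category.comp_id]
      exact h
    · refine (congrArg cap (congrArg₂ ktensor ((congrArg _ (preimage_inl_singleton_inr v)).trans
        (ctl_empty D)) (congrArg _ (preimage_inr_singleton_inr v)))).trans ?_
      have h : cap (ktensor (D.eval ≫ kunit A _) (ctl E {v})) = D.eval ⊗ₘ E.eval := by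
        rw [← Category.id_comp (ctl E {v}), comp_ktensor, comp_cap, cap_kunit_ktensor, ihE,
          ← id_tensorHom, tensorHom_comp_tensorHom, Category.id_comp, Category.comp_id]
      exact h

/-- The counit laws, coassociativity and cocommutativity say that every generator merely reshapes an
iterated `δ`. -/
lemma split_gen {X Y : Word} (g : Gen X Y) : split A X ≫ g.eval A = split A Y := by
  cases g with
  | comul =>
    have h : 𝟙 A ≫ (comul : A ⟶ A ⊗ A) = comul ≫ (𝟙 A ⊗ₘ 𝟙 A) := by simp
    exact h
  | counit => exact Category.id_comp _
  | associator X Y Z =>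
    have h : ((comul : A ⟶ A ⊗ A) ≫ ((comul ≫ (split A X ⊗ₘ split A Y)) ⊗ₘ split A Z)) ≫
        (α_ _ _ _).hom =
          comul ≫ (split A X ⊗ₘ (comul ≫ (split A Y ⊗ₘ split A Z))) := by
      have h₁ : ((comul ≫ (split A X ⊗ₘ split A Y)) ⊗ₘ split A Z) =
          (comul : A ⟶ A ⊗ A) ▷ A ≫ ((split A X ⊗ₘ split A Y) ⊗ₘ split A Z) := by
        rw [← tensorHom_id, tensorHom_comp_tensorHom, Category.id_comp]
      have h₂ : (split A X ⊗ₘ (comul ≫ (split A Y ⊗ₘ split A Z))) =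
          A ◁ (comul : A ⟶ A ⊗ A) ≫ (split A X ⊗ₘ (split A Y ⊗ₘ split A Z)) := by
        rw [← id_tensorHom, tensorHom_comp_tensorHom, Category.id_comp]
      rw [h₁, h₂, comul_assoc_assoc, Category.assoc, Category.assoc,
        MonoidalCategory.associator_naturality]
    exact h
  | leftUnitor =>
    have h : ((comul : A ⟶ A ⊗ A) ≫ (counit ⊗ₘ split A Y)) ≫ (λ_ _).hom = split A Y := by
      rw [MonoidalCategory.tensorHom_def, Category.assoc, Category.assoc, leftUnitor_naturality,
        counit_comul_assoc, Iso.inv_hom_id_assoc]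
    exact h
  | rightUnitor =>
    have h : ((comul : A ⟶ A ⊗ A) ≫ (split A Y ⊗ₘ counit)) ≫ (ρ_ _).hom = split A Y := by
      rw [MonoidalCategory.tensorHom_def', Category.assoc, Category.assoc, rightUnitor_naturality,
        comul_counit_assoc, Iso.inv_hom_id_assoc]
    exact h
  | braiding X Y =>
    have h : ((comul : A ⟶ A ⊗ A) ≫ (split A X ⊗ₘ split A Y)) ≫ (β_ _ _).hom =
        comul ≫ (split A Y ⊗ₘ split A X) := by
      rw [Category.assoc, BraidedCategory.braiding_naturality, IsCommComonObj.comul_comm_assoc]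
    exact h

lemma dagger_gen_merge {X Y : Word} (g : Gen X Y) : dagger (g.eval A) ≫ merge A X = merge A Y := by
  rw [merge, merge, ← DaggerSymmetricCategory.dagger_comp, split_gen]

/-- By the Frobenius law, a normal form with input `A` is linear over `A`, so a control wire
arriving from elsewhere can be merged into its input. -/
lemma whiskerLeft_phase_comul_act (ψ : 𝟙_ C ⟶ A) {Y : C} (s : A ⟶ Y) :
    A ◁ (phase ψ ≫ comul ≫ A ◁ s) ≫ act Y = mul ≫ phase ψ ≫ comul ≫ A ◁ s := by
  rw [whiskerLeft_comp, whiskerLeft_comp, Category.assoc, Category.assoc, act_naturality, act,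
    ← reassoc_of% mul_phase ψ, reassoc_of% @mul_comul_right]
  simp only [Category.assoc]

lemma ctl_univ {X Y : Word} (D : Diagram A X Y) :
    ctl D Set.univ = merge A X ≫ phase (pointProd D.points) ≫ comul ≫ A ◁ split A Y := by
  have hnil : phase (pointProd ([] : List (𝟙_ C ⟶ A))) = 𝟙 A := phase_one
  induction D with
  | id X =>
    rw [Diagram.points, hnil, Category.id_comp]
    exact att_univ A X
  | gen g =>
    have h : att A _ (g.graph.input ⁻¹' Set.univ) ≫ A ◁ g.eval A =
        merge A _ ≫ comul ≫ A ◁ split A _ := by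
      rw [Set.preimage_univ, att_univ, ← split_gen g, whiskerLeft_comp]
      simp only [Category.assoc]
    rw [Diagram.points, hnil, Category.id_comp]
    exact h
  | genDagger g =>
    have h : dagger (g.eval A) ≫ att A _ (g.graph.input ⁻¹' Set.univ) =
        merge A _ ≫ comul ≫ A ◁ split A _ := by
      rw [Set.preimage_univ, att_univ, ← dagger_gen_merge g, Category.assoc]
    rw [Diagram.points, hnil, Category.id_comp]
    exact h
  | point ψ =>
    have h : ψ ≫ comul = one ≫ phase (pointProd [ψ]) ≫ comul ≫ A ◁ 𝟙 A := by
      rw [pointProd, phase_pointMul, hnil, Category.id_comp, reassoc_of% one_phase ψ,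
        whiskerLeft_id, Category.comp_id]
    exact (congrArg (ψ ≫ ·) (joinIf_of_true (Set.mem_univ ()))).trans h
  | @comp X Y Z D E ihD ihE =>
    have h : kcomp (merge A X ≫ phase (pointProd D.points) ≫ comul ≫ A ◁ split A Y)
        (merge A Y ≫ phase (pointProd E.points) ≫ comul ≫ A ◁ split A Z) =
        merge A X ≫ phase (pointProd (D.points ++ E.points)) ≫ comul ≫ A ◁ split A Z := by
      have h₁ := comul_split_merge_mul A Y
      rw [whiskerLeft_comp_assoc] at h₁
      rw [phase_pointProd_append, kcomp]
      simp only [Category.assoc]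
      -- Linearity brings the control wire of `D` to the input of the second normal form, where it
      -- runs parallel to the wires of `Y` and `h₁` collapses both.
      rw [whiskerLeft_comp_assoc, whiskerLeft_phase_comul_act, reassoc_of% h₁]
    exact (congrArg₂ kcomp ihD ihE).trans h
  | @tensor X₁ Y₁ X₂ Y₂ D E ihD ihE =>
    have h : ktensor (merge A X₁ ≫ phase (pointProd D.points) ≫ comul ≫ A ◁ split A Y₁)
        (merge A X₂ ≫ phase (pointProd E.points) ≫ comul ≫ A ◁ split A Y₂) =
        ((merge A X₁ ⊗ₘ merge A X₂) ≫ mul) ≫ phase (pointProd (D.points ++ E.points)) ≫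
          comul ≫ A ◁ (comul ≫ (split A Y₁ ⊗ₘ split A Y₂)) := by
      have h₁ := ktensor_merge_split (merge A X₁ ≫ phase (pointProd D.points))
        (merge A X₂ ≫ phase (pointProd E.points)) (split A Y₁) (split A Y₂)
      simp only [Category.assoc] at h₁
      -- The phases of both parts are pulled through the multiplication that fuses them.
      rw [h₁, phase_pointProd_append, ← tensorHom_comp_tensorHom, MonoidalCategory.tensorHom_def
        (phase _)]
      simp only [Category.assoc]
      rw [reassoc_of% mul_phase (pointProd E.points), reassoc_of% phase_mul (pointProd D.points)]
    rw [merge_tensor]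
    exact (congrArg₂ ktensor ihD ihE).trans h

end Diagrams

end ObservableStructure

theorem mainTheorem5 {C : Type u} [Category.{v} C] [MonoidalCategory C] [SymmetricCategory C]
    [DaggerSymmetricCategory C] (A : C) [ObservableStructure A] (n m : ℕ)
    (f : ObservableStructure.tensorPow A n ⟶ ObservableStructure.tensorPow A m)
    (D : ObservableStructure.Diagram A
      (ObservableStructure.Word.pow n) (ObservableStructure.Word.pow m))
    (hf : D.eval = f) (hD : D.Connected) :
    f = dagger (ObservableStructure.copy A n) ≫
      ObservableStructure.phase (ObservableStructure.pointProd D.points) ≫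
      ObservableStructure.copy A m := by
  obtain ⟨v⟩ := hD.nonempty
  have h := ObservableStructure.apply_singleton_eq_univ hD
    (ObservableStructure.ctl D) (ObservableStructure.ctl_insert_of_adj D) v
  -- Any vertex `v` will do; one exists because a connected graph is nonempty.
  rw [← hf, ← ObservableStructure.cap_ctl_singleton D v, h, ObservableStructure.ctl_univ,
    ObservableStructure.comp_cap, ObservableStructure.comp_cap,
    ObservableStructure.cap_whiskerLeft, ObservableStructure.cap_comul, Category.id_comp,
    ObservableStructure.copy_eq_split, ObservableStructure.copy_eq_split,
    ObservableStructure.merge]
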